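/- A GF(2)-grammar over an alphabet $\Sigma$ is an ordinary context-free grammar $G$ with finitely many rules and initial symbol $S$, such that every string $w\in\Sigma^*$ has only finitely many parse trees rooted at $S$; the language it describes is the set of all strings $w$ with an odd number of parse trees rooted at $S$. Theorem 3.2. Let $a\neq b$ be two letters of $\Sigma$ (for example $\Sigma=\{a,b\}$), and suppose that $L\subseteq a^*b^*$ is described by a GF(2)-grammar over $\Sigma$. Let $\mathbb F_2$ be the two-element field, let $\mathrm{Dual}(L)=\sum_{a^nb^m\in L}a^nb^m\in\mathbb F_2[[a,b]]$, where on the right $a,b$ are commuting variables, and write $\mathrm{Dual}(L)=\sum_{i=0}^{\infty}a^i\,\ell(i)$ with $\ell(i)\in\mathbb F_2[[b]]$. Then there exist an integer $d\ge 0$ and polynomials $p_0,p_1,\dots,p_d\in\mathbb F_2[b]$ with $p_d\neq 0$ such that $$\sum_{i=0}^{d}p_i\,\ell(n-i)\in\mathbb F_2[[b]]$$ takes only finitely many distinct values as $n$ ranges over all integers $n>d$. -/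

import Mathlib

open scoped Computability

universe u

mutual
/-- Parse trees of the context-free grammar `g` whose root is labelled by the nonterminal `A`:
a rule `r` of `g` with left-hand side `A`, together with a sequence of subtrees, one for each
symbol of the right-hand side of `r`. -/
inductive ParseTree {T : Type u} (g : ContextFreeGrammar.{u} T) : g.NT → Type u
  | node {A : g.NT} (r : ContextFreeRule T g.NT) (mem : r ∈ g.rules) (input_eq : r.input = A)
      (children : ParseForest g r.output) : ParseTree g A

/-- Sequences of parse trees of `g` whose roots are labelled, in order, by the symbols of a given
string; the tree of a terminal symbol is a single leaf. -/
inductive ParseForest {T : Type u} (g : ContextFreeGrammar.{u} T) : List (Symbol T g.NT) → Type u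
  | nil : ParseForest g []
  | terminal {s : List (Symbol T g.NT)} (t : T) (rest : ParseForest g s) :
      ParseForest g (Symbol.terminal t :: s)
  | nonterminal {s : List (Symbol T g.NT)} {A : g.NT} (tree : ParseTree g A)
      (rest : ParseForest g s) : ParseForest g (Symbol.nonterminal A :: s)
end

mutual
/-- The string of terminals at the leaves of a parse tree, read from left to right. -/
def ParseTree.yield {T : Type u} {g : ContextFreeGrammar.{u} T} {A : g.NT} :
    ParseTree g A → List T
  | .node _ _ _ children => children.yield

/-- The string of terminals at the leaves of a sequence of parse trees. -/
def ParseForest.yield {T : Type u} {g : ContextFreeGrammar.{u} T} {s : List (Symbol T g.NT)} :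
    ParseForest g s → List T
  | .nil => []
  | .terminal t rest => t :: rest.yield
  | .nonterminal tree rest => tree.yield ++ rest.yield
end

/-- The parse trees of the string `w` as the nonterminal `A`. -/
def parseTrees {T : Type u} (g : ContextFreeGrammar.{u} T) (A : g.NT) (w : List T) :
    Set (ParseTree g A) :=
  {t | t.yield = w}

/-- A GF(2)-grammar: a (finite set of rules of a) context-free grammar in which every string has
only finitely many parse trees. -/
structure GF2Grammar (T : Type u) extends ContextFreeGrammar.{u} T where
  /-- Every string has finitely many parse trees (with the initial symbol at the root). -/
  finite_parseTrees : ∀ w : List T, (parseTrees toContextFreeGrammar initial w).Finite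

/-- The language of a GF(2)-grammar: the strings with an odd number of parse trees. -/
def GF2Grammar.language {T : Type u} (G : GF2Grammar T) : Language T :=
  {w | Odd (parseTrees G.toContextFreeGrammar G.initial w).ncard}

/-- The language `L` is described by some GF(2)-grammar. -/
def IsGF2Grammatical {T : Type u} (L : Language T) : Prop :=
  ∃ G : GF2Grammar T, G.language = L

/-- The language `a^* b^*`. -/
def starStar {T : Type u} (a b : T) : Language T :=
  ({[a]} : Language T)∗ * ({[b]} : Language T)∗

open scoped Classical in
/-- The formal power series over GF(2) in two commuting variables (variable `0` plays the role of
`a`, variable `1` that of `b`) in which the monomial `a^n b^m` has coefficient `1` if the string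
`a^n b^m` is in `L`, and coefficient `0` otherwise. -/
noncomputable def dual {T : Type u} (a b : T) (L : Language T) : MvPowerSeries (Fin 2) (ZMod 2) :=
  fun e => if List.replicate (e 0) a ++ List.replicate (e 1) b ∈ L then 1 else 0

/-- The coefficient `ℓ(i)`, a power series in the variable `1`, of the `i`-th power of the
variable `0` in a two-variable power series `f`, that is, `f = ∑ i, a^i ℓ(i)`. -/
noncomputable def coeffA (f : MvPowerSeries (Fin 2) (ZMod 2)) (i : ℕ) : PowerSeries (ZMod 2) :=
  PowerSeries.mk fun j => MvPowerSeries.coeff (Finsupp.single 0 i + Finsupp.single 1 j) f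

-- Jacobian criterion for algebraicity

section Jacobian

open MvPolynomial

-- Count parse trees mod 2 to get a noncommutative series for each useful nonterminal, and cut it
-- into its parts on `a^*`, `b^*` and `a^* b^+`, viewed as series in `a` (outer) over series in `b`
-- (inner). The first two parts are multiplicative and solve polynomial systems; the third obeys a
-- twisted Leibniz rule (`abPart_wordConv`), hence solves a linear system whose coefficients come
-- from the first two.
--
-- Both kinds of system lead to a determinant `det (1 - M)`. Its constant term is nonzero, since a
-- cycle among the constant terms of `M` would give arbitrarily large parse trees of one string
-- (`det_one_sub_contextMatrix_symbolCount_nil_ne_zero`). So the `a^*` and `b^*` parts are algebraic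
-- (`isAlgebraic_of_polynomialSystem`). In the linear system the determinant is therefore algebraic
-- and divides a nonzero polynomial `p`, and Cramer's rule
-- (`exists_algebraMap_mul_mem_of_linearSystem`) puts `p` times the `a^* b^+` part into the ring
-- generated by the known parts. Series there have all their `a`-coefficients in a
-- finite-dimensional, hence finite, space over `ZMod 2`. The coefficients of `p` in powers of `a`
-- are the required `p_i`.

theorem Derivation.map_aeval_mvPolynomial {R A M ι : Type*} [CommRing R] [CommRing A] [Algebra R A]
    [AddCommGroup M] [Module R M] [Module A M] [Fintype ι]
    (D : Derivation R A M) (x : ι → A) (f : MvPolynomial ι R) :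
    D (aeval x f) = ∑ j, aeval x (pderiv j f) • D (x j) := by
  induction f using MvPolynomial.induction_on with
  | C r => simp
  | add p q hp hq => simp only [map_add, hp, hq, add_smul, Finset.sum_add_distrib]
  | mul_X p i hp =>
    classical
    simp only [map_mul, Derivation.leibniz, hp, aeval_X, pderiv_X, smul_eq_mul, map_add, add_smul,
      Finset.sum_add_distrib, Finset.smul_sum, mul_smul]
    congr 1
    rw [Finset.sum_eq_single i]
    · simp
    · intro j _ hj
      simp [hj.symm]
    · simp

/-- A solution of a square system of polynomial equations `x = f x` over a field at which the
Jacobian determinant does not vanish has algebraic coordinates. -/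
theorem isAlgebraic_of_polynomialSystem_field {k F ι : Type*} [Field k] [Field F] [Algebra k F]
    [Fintype ι] [DecidableEq ι] (f : ι → MvPolynomial ι k) (x : ι → F)
    (hx : ∀ i, x i = aeval x (f i))
    (hdet : (1 - Matrix.of fun i j => aeval x (pderiv j (f i))).det ≠ 0) (i : ι) :
    IsAlgebraic k (x i) := by
  let E := IntermediateField.adjoin k (Set.range x)
  have hmem (i) : x i ∈ E := IntermediateField.subset_adjoin _ _ ⟨i, rfl⟩
  let y : ι → E := fun i => ⟨x i, hmem i⟩
  have haeval (p : MvPolynomial ι k) : aeval x p = algebraMap E F (aeval y p) := by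
    rw [← MvPolynomial.aeval_algebraMap_apply]
    rfl
  have hy (i) : y i = aeval y (f i) := by
    apply (algebraMap E F).injective
    rw [← haeval]
    exact hx i
  have hdet' : (1 - Matrix.of fun i j => aeval y (pderiv j (f i))).det ≠ 0 := by
    intro h
    apply hdet
    have := congrArg (algebraMap E F) h
    rw [RingHom.map_det, map_zero] at this
    rw [← this, map_sub, map_one]
    congr 2
    ext i j
    exact haeval _
  have hess : Algebra.EssFiniteType k E := by
    rw [IntermediateField.essFiniteType_iff]
    exact IntermediateField.fg_adjoin_of_finite (Set.finite_range x)
  -- Differentiating `y = f y` puts the vector of differentials in the kernel of the invertible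
  -- matrix `1 - J`.
  have hD (j) : KaehlerDifferential.D k E (y j) = 0 := by
    set D := KaehlerDifferential.D k E
    set M : Matrix ι ι E := 1 - Matrix.of fun i j => aeval y (pderiv j (f i)) with hM
    have hMD (i) : ∑ j, M i j • D (y j) = 0 := by
      simp only [hM, Matrix.sub_apply, sub_smul, Finset.sum_sub_distrib, Matrix.of_apply,
        ← Derivation.map_aeval_mvPolynomial, ← hy]
      simp [Matrix.one_apply]
    have : ∑ i, M⁻¹ j i • ∑ l, M i l • D (y l) = D (y j) := by
      simp only [Finset.smul_sum, smul_smul]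
      rw [Finset.sum_comm]
      simp only [← Finset.sum_smul, ← Matrix.mul_apply]
      rw [Matrix.nonsing_inv_mul _ (isUnit_iff_ne_zero.2 hdet')]
      simp [Matrix.one_apply]
    rw [← this]
    simp [hMD]
  have hD0 (z : E) : KaehlerDifferential.D k E z = 0 := by
    obtain ⟨z, hz⟩ := z
    induction hz using IntermediateField.adjoin_induction with
    | mem z hz => obtain ⟨j, rfl⟩ := hz; exact hD j
    | algebraMap r => exact (KaehlerDifferential.D k E).map_algebraMap r
    | add u v hu hv h1 h2 =>
      have := (KaehlerDifferential.D k E).map_add ⟨u, hu⟩ ⟨v, hv⟩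
      rwa [h1, h2, add_zero] at this
    | inv u hu h =>
      have := (KaehlerDifferential.D k E).leibniz_inv ⟨u, hu⟩
      rwa [h, smul_zero] at this
    | mul u v hu hv h1 h2 =>
      have := (KaehlerDifferential.D k E).leibniz ⟨u, hu⟩ ⟨v, hv⟩
      rwa [h1, h2, smul_zero, smul_zero, add_zero] at this
  -- All differentials vanish, so the module they span is zero; an essentially finite unramified
  -- field extension is separable algebraic.
  have : Algebra.FormallyUnramified k E := by
    refine ⟨?_⟩
    rw [← Submodule.subsingleton_iff E, ← subsingleton_iff_bot_eq_top,
      ← KaehlerDifferential.span_range_derivation, eq_comm, Submodule.span_eq_bot]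
    rintro _ ⟨z, rfl⟩
    exact hD0 z
  have := Algebra.FormallyUnramified.isSeparable k E
  exact (IntermediateField.isAlgebraic_iff).1 (Algebra.IsAlgebraic.isAlgebraic (y i))

theorem isAlgebraic_of_polynomialSystem {R K ι : Type*} [CommRing R] [IsDomain R] [CommRing K]
    [IsDomain K] [Algebra R K] [FaithfulSMul R K] [Fintype ι] [DecidableEq ι]
    (f : ι → MvPolynomial ι R) (x : ι → K) (hx : ∀ i, x i = aeval x (f i))
    (hdet : (1 - Matrix.of fun i j => aeval x (pderiv j (f i))).det ≠ 0) (i : ι) :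
    IsAlgebraic R (x i) := by
  let k := FractionRing R
  let F := FractionRing K
  let : Algebra k F := FractionRing.liftAlgebra R F
  have haeval (p : MvPolynomial ι R) :
      aeval (fun i => algebraMap K F (x i)) (p.map (algebraMap R k)) =
        algebraMap K F (aeval x p) := by
    rw [MvPolynomial.aeval_map_algebraMap, ← MvPolynomial.aeval_algebraMap_apply]
    rfl
  have h := isAlgebraic_of_polynomialSystem_field (k := k) (F := F)
    (fun i => (f i).map (algebraMap R k)) (fun i => algebraMap K F (x i))
    (fun i => by rw [haeval, ← hx]) (by
      intro h
      apply hdet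
      apply IsFractionRing.injective K F
      rw [RingHom.map_det, map_zero, ← h]
      congr 1
      ext i j
      simp [pderiv_map, haeval, Matrix.one_apply, apply_ite (algebraMap K F)]) i
  rw [← IsFractionRing.isAlgebraic_iff R k F] at h
  exact (isAlgebraic_algebraMap_iff (IsFractionRing.injective K F)).1 h

end Jacobian

-- Cramer's rule with an algebraic determinant

/-- If `(1 - M) q = f` where the entries of `M` and `f` lie in an algebraic subalgebra `B` and
`1 - M` has nonzero determinant, then a nonzero multiple of each coordinate of `q` lies in `B`. -/
theorem exists_algebraMap_mul_mem_of_linearSystem {R K ι : Type*} [CommRing R] [CommRing K]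
    [IsDomain K] [Algebra R K] [Fintype ι] [DecidableEq ι] (B : Subalgebra R K)
    (hB : ∀ z ∈ B, IsAlgebraic R z) (M : Matrix ι ι K) (f q : ι → K) (hM : ∀ i j, M i j ∈ B)
    (hf : ∀ i, f i ∈ B) (hq : ∀ i, q i = f i + ∑ j, M i j * q j) (hdet : (1 - M).det ≠ 0) (i : ι) :
    ∃ p : R, p ≠ 0 ∧ algebraMap R K p * q i ∈ B := by
  let M' : Matrix ι ι B := Matrix.of fun i j => ⟨M i j, hM i j⟩
  have hmap : B.val.toRingHom.mapMatrix (1 - M') = 1 - M := by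
    rw [map_sub, map_one]
    rfl
  have hdet' : B.val (1 - M').det = (1 - M).det := by
    rw [← hmap]
    exact RingHom.map_det B.val.toRingHom _
  have halg : IsAlgebraic R (1 - M').det := by
    rw [← isAlgebraic_algHom_iff B.val Subtype.val_injective]
    exact hB _ (Subtype.property _)
  have hne : (1 - M').det ≠ 0 := by
    intro h
    rw [h, map_zero] at hdet'
    exact hdet hdet'.symm
  obtain ⟨p, hp, u, hu⟩ := halg.exists_nonzero_dvd (mem_nonZeroDivisors_of_ne_zero hne)
  refine ⟨p, hp, ?_⟩
  have hsys : (1 - M).mulVec q = f := by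
    rw [Matrix.sub_mulVec, Matrix.one_mulVec]
    ext i
    simp only [Pi.sub_apply, Matrix.mulVec, dotProduct]
    rw [sub_eq_iff_eq_add]
    exact hq i
  -- The adjugate avoids division, so the right-hand side stays in `B`.
  have hcramer : (1 - M).det • q = (1 - M).adjugate.mulVec f := by
    rw [← hsys, Matrix.mulVec_mulVec, Matrix.adjugate_mul, Matrix.smul_mulVec, Matrix.one_mulVec]
  have hadj (i j) : (1 - M).adjugate i j ∈ B := by
    rw [← hmap, ← RingHom.map_adjugate]
    exact Subtype.property ((1 - M').adjugate i j)
  have hpu : algebraMap R K p = (1 - M).det * B.val u := by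
    rw [← hdet', ← map_mul, ← hu]
    rfl
  rw [hpu, mul_right_comm, mul_comm]
  refine B.mul_mem u.2 ?_
  have := congrFun hcramer i
  simp only [Pi.smul_apply, smul_eq_mul] at this
  rw [this]
  exact B.sum_mem fun j _ => B.mul_mem (hadj i j) (hf j)
-- Double series with coefficients in a finitely generated module
section Series

open PowerSeries Polynomial

theorem PowerSeries.coeff_algebraMap_polynomial_polynomial {k : Type*} [CommRing k] (p : k[X][X])
    (n : ℕ) : coeff n (algebraMap k[X][X] k⟦X⟧⟦X⟧ p) = (p.coeff n : k⟦X⟧) := by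
  rw [algebraMap_apply', PowerSeries.coeff_map, Polynomial.coeff_coe, algebraMap_apply']
  simp

instance {k : Type*} [CommRing k] : FaithfulSMul k[X][X] k⟦X⟧⟦X⟧ := by
  rw [faithfulSMul_iff_algebraMap_injective, injective_iff_map_eq_zero]
  intro p hp
  ext1 n
  have := PowerSeries.coeff_algebraMap_polynomial_polynomial p n
  rw [hp, map_zero] at this
  simpa using this.symm

/-- The double power series whose coefficients with respect to the outer variable lie in a
finitely generated `k`-module. -/
def fgCoeffSubalgebra (k : Type*) [CommRing k] : Subalgebra k[X][X] k⟦X⟧⟦X⟧ where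
  carrier := {f | ∃ V : Submodule k k⟦X⟧, V.FG ∧ ∀ n, coeff n f ∈ V}
  mul_mem' := by
    rintro f g ⟨V, hV, hf⟩ ⟨W, hW, hg⟩
    refine ⟨V * W, hV.mul hW, fun n => ?_⟩
    rw [PowerSeries.coeff_mul]
    exact Submodule.sum_mem _ fun i _ => Submodule.mul_mem_mul (hf _) (hg _)
  add_mem' := by
    rintro f g ⟨V, hV, hf⟩ ⟨W, hW, hg⟩
    refine ⟨V ⊔ W, hV.sup hW, fun n => ?_⟩
    rw [map_add]
    exact Submodule.add_mem_sup (hf n) (hg n)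
  algebraMap_mem' p := by
    refine ⟨Submodule.span k ((fun n => (p.coeff n : k⟦X⟧)) '' p.support),
      Submodule.fg_span (Set.Finite.image _ p.support.finite_toSet), fun n => ?_⟩
    rw [PowerSeries.coeff_algebraMap_polynomial_polynomial]
    by_cases hn : n ∈ p.support
    · exact Submodule.subset_span ⟨n, hn, rfl⟩
    · rw [Polynomial.notMem_support_iff.1 hn]
      simp

theorem C_mem_fgCoeffSubalgebra {k : Type*} [CommRing k] (g : k⟦X⟧) :
    PowerSeries.C g ∈ fgCoeffSubalgebra k := by
  refine ⟨Submodule.span k {g}, Submodule.fg_span (Set.finite_singleton g), fun n => ?_⟩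
  rw [PowerSeries.coeff_C]
  split_ifs
  · exact Submodule.mem_span_singleton_self g
  · exact Submodule.zero_mem _

theorem map_C_mem_fgCoeffSubalgebra {k : Type*} [CommRing k] (g : k⟦X⟧) :
    PowerSeries.map PowerSeries.C g ∈ fgCoeffSubalgebra k := by
  refine ⟨Submodule.span k {1}, Submodule.fg_span (Set.finite_singleton 1), fun n => ?_⟩
  rw [PowerSeries.coeff_map, Submodule.mem_span_singleton]
  exact ⟨coeff n g, by rw [PowerSeries.smul_eq_C_mul, mul_one]⟩

/-- For `n` beyond the degree of `p`, no term of the convolution is truncated, so the sum is the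
`n`-th coefficient of `p * h`; it lies in a finitely generated module over a finite ring, which is
finite. -/
theorem finite_sum_polynomial_mul_coeff {k : Type*} [CommRing k] [Finite k] (p : k[X][X])
    (h : k⟦X⟧⟦X⟧) (hp : algebraMap k[X][X] k⟦X⟧⟦X⟧ p * h ∈ fgCoeffSubalgebra k) :
    {s : k⟦X⟧ | ∃ n : ℕ, p.natDegree < n ∧
      s = ∑ i : Fin (p.natDegree + 1), (p.coeff i : k⟦X⟧) * coeff (n - (i : ℕ)) h}.Finite := by
  obtain ⟨V, hV, hmem⟩ := hp
  have : Module.Finite k V := Module.Finite.iff_fg.2 hV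
  have : Finite V := Module.finite_of_finite k
  refine (Set.toFinite (V : Set k⟦X⟧)).subset ?_
  rintro _ ⟨n, hn, rfl⟩
  have := hmem n
  rw [PowerSeries.coeff_mul, Finset.Nat.sum_antidiagonal_eq_sum_range_succ_mk] at this
  rw [Fin.sum_univ_eq_sum_range fun i => (p.coeff i : k⟦X⟧) * coeff (n - i) h]
  rw [← Finset.sum_subset (Finset.range_subset_range.2 (by lia : p.natDegree + 1 ≤ n + 1))] at this
  · simp only [PowerSeries.coeff_algebraMap_polynomial_polynomial] at this
    exact this
  · intro i _ hi
    rw [PowerSeries.coeff_algebraMap_polynomial_polynomial,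
      Polynomial.coeff_eq_zero_of_natDegree_lt (by simpa using hi)]
    simp

end Series

-- Noncommutative series and their parts on `a^*`, `b^*`, `a^* b^+`

section WordSeries

open PowerSeries

variable {T k : Type*} [CommRing k]

/-- The product of two noncommutative power series. -/
def wordConv (f g : List T → k) (w : List T) : k :=
  ∑ i ∈ Finset.range (w.length + 1), f (w.take i) * g (w.drop i)

open scoped Classical in
/-- The noncommutative power series consisting of a single word. -/
noncomputable def wordSingle (k : Type*) [CommRing k] (u w : List T) : k := if w = u then 1 else 0

/-- The part of a noncommutative power series supported on `a^*`. -/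
noncomputable def aPart (a : T) (f : List T → k) : k⟦X⟧⟦X⟧ :=
  PowerSeries.map C (mk fun n => f (List.replicate n a))

/-- The part of a noncommutative power series supported on `b^*`. -/
noncomputable def bPart (b : T) (f : List T → k) : k⟦X⟧⟦X⟧ :=
  C (mk fun m => f (List.replicate m b))

/-- The part of a noncommutative power series supported on `a^* b^+`. -/
noncomputable def abPart (a b : T) (f : List T → k) : k⟦X⟧⟦X⟧ :=
  -- Words with `m = 0` belong to `aPart`; excluding them here avoids counting them twice.
  mk fun n => mk fun m => if m = 0 then 0 else f (List.replicate n a ++ List.replicate m b)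

theorem mk_wordConv_replicate (a : T) (f g : List T → k) :
    (mk fun n => wordConv f g (List.replicate n a)) =
      (mk fun n => f (List.replicate n a)) * mk fun n => g (List.replicate n a) := by
  ext n
  rw [coeff_mul, Finset.Nat.sum_antidiagonal_eq_sum_range_succ_mk, coeff_mk, wordConv,
    List.length_replicate]
  refine Finset.sum_congr rfl fun i hi => ?_
  rw [Finset.mem_range] at hi
  simp [List.take_replicate, List.drop_replicate, Nat.min_eq_left (Nat.lt_succ_iff.1 hi)]

theorem aPart_wordConv (a : T) (f g : List T → k) :
    aPart a (wordConv f g) = aPart a f * aPart a g := by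
  rw [aPart, mk_wordConv_replicate, map_mul]
  rfl

theorem bPart_wordConv (b : T) (f g : List T → k) :
    bPart b (wordConv f g) = bPart b f * bPart b g := by
  rw [bPart, mk_wordConv_replicate, map_mul]
  rfl

theorem wordConv_replicate_append_replicate (a b : T) (f g : List T → k) (n m : ℕ) :
    wordConv f g (List.replicate n a ++ List.replicate m b) =
      (∑ i ∈ Finset.range (n + 1), f (List.replicate i a) *
        g (List.replicate (n - i) a ++ List.replicate m b)) +
      ∑ j ∈ Finset.range m, f (List.replicate n a ++ List.replicate (j + 1) b) *
        g (List.replicate (m - (j + 1)) b) := by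
  have : (List.replicate n a ++ List.replicate m b).length + 1 = (n + 1) + m := by
    simp
    ring
  rw [wordConv, this, Finset.sum_range_add]
  congr 1
  · refine Finset.sum_congr rfl fun i hi => ?_
    have hi : i ≤ n := Nat.lt_succ_iff.1 (Finset.mem_range.1 hi)
    simp [List.take_append, List.drop_append, List.take_replicate, List.drop_replicate, hi,
      Nat.sub_eq_zero_of_le hi]
  · refine Finset.sum_congr rfl fun j hj => ?_
    have hj : j + 1 ≤ m := Finset.mem_range.1 hj
    have h1 : n + 1 + j - n = j + 1 := by lia
    have h2 : n - (n + 1 + j) = 0 := by lia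
    simp [List.take_append, List.drop_append, List.take_replicate, List.drop_replicate, hj, h1, h2,
      (by lia : n ≤ n + 1 + j)]

/-- A cut of `a^n b^m` with `m > 0` falls either at or before the end of the `a`-block, leaving a
prefix in `a^*`, or after at least one `b`, leaving a suffix in `b^*`. -/
theorem abPart_wordConv (a b : T) (f g : List T → k) :
    abPart a b (wordConv f g) = aPart a f * abPart a b g + abPart a b f * bPart b g := by
  ext n m
  rcases Nat.eq_zero_or_pos m with rfl | hm
  · simp [abPart, aPart, bPart, coeff_mul]
  · simp only [abPart, aPart, bPart, map_add, coeff_mk, hm.ne', if_false,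
      wordConv_replicate_append_replicate]
    congr 1
    · rw [coeff_mul, Finset.Nat.sum_antidiagonal_eq_sum_range_succ_mk, map_sum]
      refine Finset.sum_congr rfl fun i _ => ?_
      simp [hm.ne']
    · rw [coeff_mul_C, coeff_mul, Finset.Nat.sum_antidiagonal_eq_sum_range_succ_mk,
        Finset.sum_range_succ']
      simp

theorem aPart_wordSingle_nil (a : T) : aPart a (wordSingle k []) = 1 := by
  rw [aPart, ← map_one (PowerSeries.map C)]
  congr 1
  ext n
  simp [wordSingle, coeff_one]

theorem bPart_wordSingle_nil (b : T) : bPart b (wordSingle k []) = 1 := by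
  rw [bPart, ← map_one C]
  congr 1
  ext n
  simp [wordSingle, coeff_one]

theorem abPart_wordSingle_nil (a b : T) : abPart a b (wordSingle k []) = 0 := by
  ext n m
  simp +contextual [abPart, wordSingle]

open scoped Classical in
theorem mk_wordSingle_singleton_replicate (a t : T) :
    (mk fun n => wordSingle k [t] (List.replicate n a)) = if a = t then X else 0 := by
  ext n
  split_ifs with h
  · rcases n with _ | _ | n <;> simp [wordSingle, List.replicate_succ, coeff_X, h]
  · rcases n with _ | _ | n <;> simp [wordSingle, List.replicate_succ, h]

theorem abPart_wordSingle_singleton (a b t : T) :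
    abPart a b (wordSingle k [t]) = bPart b (wordSingle k [t]) := by
  ext n m
  simp only [abPart, bPart, coeff_mk, coeff_C, wordSingle]
  rcases n with _ | n
  · rcases m with _ | m <;> simp
  · rcases m with _ | m <;> simp [List.replicate_succ]

open scoped Classical in
theorem aPart_wordSingle_singleton (a t : T) : aPart a (wordSingle k [t]) =
    algebraMap (Polynomial (Polynomial k)) k⟦X⟧⟦X⟧ (if a = t then Polynomial.X else 0) := by
  rw [aPart, mk_wordSingle_singleton_replicate]
  split_ifs <;> simp [algebraMap_apply']

open scoped Classical in
theorem bPart_wordSingle_singleton (b t : T) : bPart b (wordSingle k [t]) =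
    algebraMap (Polynomial (Polynomial k)) k⟦X⟧⟦X⟧
      (if b = t then Polynomial.C Polynomial.X else 0) := by
  rw [bPart, mk_wordSingle_singleton_replicate]
  split_ifs <;> simp [algebraMap_apply']

@[simp]
theorem constantCoeff_aPart (a : T) (f : List T → k) :
    constantCoeff (constantCoeff (aPart a f)) = f [] := by
  simp [aPart, ← coeff_zero_eq_constantCoeff_apply]

@[simp]
theorem constantCoeff_bPart (b : T) (f : List T → k) :
    constantCoeff (constantCoeff (bPart b f)) = f [] := by
  simp [bPart, ← coeff_zero_eq_constantCoeff_apply]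

theorem aPart_sum {ι : Type*} (a : T) (s : Finset ι) (f : ι → List T → k) :
    aPart a (fun w => ∑ i ∈ s, f i w) = ∑ i ∈ s, aPart a (f i) := by
  ext n m
  simp [aPart]

theorem bPart_sum {ι : Type*} (b : T) (s : Finset ι) (f : ι → List T → k) :
    bPart b (fun w => ∑ i ∈ s, f i w) = ∑ i ∈ s, bPart b (f i) := by
  simp only [bPart, ← map_sum]
  congr 1
  ext m
  simp

theorem abPart_sum {ι : Type*} (a b : T) (s : Finset ι) (f : ι → List T → k) :
    abPart a b (fun w => ∑ i ∈ s, f i w) = ∑ i ∈ s, abPart a b (f i) := by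
  ext n m
  simp only [abPart, map_sum, coeff_mk]
  split_ifs <;> simp

theorem aPart_mem_fgCoeffSubalgebra (a : T) (f : List T → k) :
    aPart a f ∈ fgCoeffSubalgebra k :=
  map_C_mem_fgCoeffSubalgebra _

theorem bPart_mem_fgCoeffSubalgebra (b : T) (f : List T → k) :
    bPart b f ∈ fgCoeffSubalgebra k :=
  C_mem_fgCoeffSubalgebra _

theorem coeff_aPart_add_abPart (a b : T) (f : List T → k) (n : ℕ) :
    coeff n (aPart a f + abPart a b f) =
      mk fun m => f (List.replicate n a ++ List.replicate m b) := by
  ext m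
  rcases m with _ | m <;> simp [aPart, abPart]

end WordSeries

-- Counting parse trees over useful nonterminals

section ParseTrees

variable {T : Type u} {g : ContextFreeGrammar.{u} T}

mutual
/-- The number of internal nodes of a parse tree. -/
def ParseTree.numNodes {T : Type u} {g : ContextFreeGrammar.{u} T} {A : g.NT} :
    ParseTree g A → ℕ
  | .node _ _ _ children => children.numNodes + 1

/-- The number of internal nodes of a sequence of parse trees. -/
def ParseForest.numNodes {T : Type u} {g : ContextFreeGrammar.{u} T} {s : List (Symbol T g.NT)} :
    ParseForest g s → ℕ
  | .nil => 0
  | .terminal _ rest => rest.numNodes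
  | .nonterminal tree rest => tree.numNodes + rest.numNodes
end

/-- The sequences of parse trees with given roots and a given yield. -/
def parseForests (g : ContextFreeGrammar.{u} T) (s : List (Symbol T g.NT)) (w : List T) :
    Set (ParseForest g s) :=
  {f | f.yield = w}

/-- A nonterminal is useful if it has some parse tree, but only finitely many for each string. -/
def IsUseful (g : ContextFreeGrammar.{u} T) (A : g.NT) : Prop :=
  Nonempty (ParseTree g A) ∧ ∀ w, (parseTrees g A w).Finite

theorem finite_setOf_isUseful (g : ContextFreeGrammar.{u} T) : {A | IsUseful g A}.Finite := by
  classical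
  refine (g.rules.image ContextFreeRule.input).finite_toSet.subset ?_
  rintro A ⟨⟨⟨r, hr, rfl, _⟩⟩, _⟩
  exact Finset.mem_coe.2 (Finset.mem_image_of_mem _ hr)

/-- The cut position is recovered as the length of the first tree's yield. -/
theorem bijective_parseForest_nonterminal (A : g.NT) (s : List (Symbol T g.NT)) (w : List T) :
    Function.Bijective (fun x : Σ i : Fin (w.length + 1),
        parseTrees g A (w.take i) × parseForests g s (w.drop i) =>
      (⟨.nonterminal x.2.1.1 x.2.2.1, by
        have h1 : ParseTree.yield x.2.1.1 = _ := x.2.1.2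
        have h2 : ParseForest.yield x.2.2.1 = _ := x.2.2.2
        simp [parseForests, ParseForest.yield, h1, h2]⟩ :
          parseForests g (.nonterminal A :: s) w)) := by
  constructor
  · rintro ⟨i, ⟨t, ht⟩, f, hf⟩ ⟨j, ⟨t', ht'⟩, f', hf'⟩ h
    obtain ⟨rfl, rfl⟩ := ParseForest.nonterminal.inj (congrArg Subtype.val h)
    have hi : t.yield.length = i := by
      rw [show t.yield = _ from ht, List.length_take]
      lia
    have hj : t.yield.length = j := by
      rw [show t.yield = _ from ht', List.length_take]
      lia
    obtain rfl : i = j := Fin.ext (hi.symm.trans hj)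
    rfl
  · rintro ⟨f, hf⟩
    cases f with
    | nonterminal t f =>
      have hf : t.yield ++ f.yield = w := hf
      refine ⟨⟨⟨t.yield.length, by simp [← hf]⟩, ⟨t, ?_⟩, ⟨f, ?_⟩⟩, rfl⟩
      · simp [parseTrees, ← hf]
      · simp [parseForests, ← hf]

theorem finite_parseForests {s : List (Symbol T g.NT)}
    (hs : ∀ A, Symbol.nonterminal A ∈ s → IsUseful g A) (w : List T) :
    (parseForests g s w).Finite := by
  induction s generalizing w with
  | nil =>
    refine (Set.finite_singleton ParseForest.nil).subset ?_
    rintro ⟨⟩ _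
    rfl
  | cons x s ih =>
    replace ih := ih fun A hA => hs A (List.mem_cons_of_mem _ hA)
    cases x with
    | terminal t =>
      refine ((ih w.tail).image (ParseForest.terminal t)).subset ?_
      rintro f hf
      cases f with
      | terminal t f =>
        refine ⟨f, ?_, rfl⟩
        rw [← show t :: f.yield = w from hf]
        rfl
    | nonterminal A =>
      have h1 (w) : Finite (parseTrees g A w) := (hs A List.mem_cons_self).2 w
      have h2 (w) : Finite (parseForests g s w) := ih w
      exact Finite.of_surjective _ (bijective_parseForest_nonterminal A s w).2

/-- Keep one forest fixed except at one occurrence of `A`: infinitely many trees of a string there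
would give infinitely many forests with a common yield. -/
theorem isUseful_of_mem {s : List (Symbol T g.NT)} (hne : Nonempty (ParseForest g s))
    (hfin : ∀ w, (parseForests g s w).Finite) (A : g.NT) (hA : Symbol.nonterminal A ∈ s) :
    IsUseful g A := by
  induction s with
  | nil => simp at hA
  | cons x s ih =>
    obtain ⟨f⟩ := hne
    cases f with
    | terminal t f =>
      refine ih ⟨f⟩ (fun w => ?_) (by simpa using hA)
      refine Set.Finite.of_finite_image (f := ParseForest.terminal t)
        ((hfin (t :: w)).subset ?_) fun _ _ _ _ h => by simpa using h
      rintro _ ⟨f, rfl, rfl⟩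
      rfl
    | @nonterminal _ B t f =>
      rcases List.mem_cons.1 hA with h | h
      · obtain rfl : A = B := by simpa using h
        refine ⟨⟨t⟩, fun w => ?_⟩
        refine Set.Finite.of_finite_image (f := fun t => ParseForest.nonterminal t f)
          ((hfin (w ++ f.yield)).subset ?_) fun _ _ _ _ h => by simpa using h
        rintro _ ⟨f, rfl, rfl⟩
        rfl
      · refine ih ⟨f⟩ (fun w => ?_) h
        refine Set.Finite.of_finite_image (f := ParseForest.nonterminal t)
          ((hfin (t.yield ++ w)).subset ?_) fun _ _ _ _ h => by simpa using h
        rintro _ ⟨f, rfl, rfl⟩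
        rfl

theorem IsUseful.finite_parseForests {A : g.NT} (hA : IsUseful g A)
    {r : ContextFreeRule T g.NT} (hr : r ∈ g.rules) (hrA : r.input = A) (w : List T) :
    (parseForests g r.output w).Finite := by
  refine Set.Finite.of_finite_image (f := ParseTree.node r hr hrA)
    ((hA.2 w).subset ?_) fun _ _ _ _ h => by simpa using h
  rintro _ ⟨f, rfl, rfl⟩
  rfl

open scoped Classical in
/-- The rules for a nonterminal whose right-hand sides only involve useful nonterminals. -/
noncomputable def usefulRules (g : ContextFreeGrammar.{u} T) (A : g.NT) :
    Finset (ContextFreeRule T g.NT) :=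
  {r ∈ g.rules | r.input = A ∧ ∀ B, Symbol.nonterminal B ∈ r.output → IsUseful g B}

theorem mem_usefulRules {A : g.NT} {r : ContextFreeRule T g.NT} :
    r ∈ usefulRules g A ↔
      r ∈ g.rules ∧ r.input = A ∧ ∀ B, Symbol.nonterminal B ∈ r.output → IsUseful g B := by
  classical
  simp [usefulRules]

/-- Discarding rules outside `usefulRules` loses nothing: a rule at the root of a tree of a useful
nonterminal has only useful nonterminals on its right. -/
theorem bijective_parseTree_node {A : g.NT} (hA : IsUseful g A) (w : List T) :
    Function.Bijective (fun x : Σ r : usefulRules g A, parseForests g r.1.output w =>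
      (⟨.node x.1.1 (mem_usefulRules.1 x.1.2).1 (mem_usefulRules.1 x.1.2).2.1 x.2.1, x.2.2⟩ :
          parseTrees g A w)) := by
  constructor
  · rintro ⟨⟨r, hr⟩, f, hf⟩ ⟨⟨r', hr'⟩, f', hf'⟩ h
    obtain ⟨rfl, h⟩ := ParseTree.node.inj (congrArg Subtype.val h)
    obtain rfl := eq_of_heq h
    rfl
  · rintro ⟨⟨r, hr, hrA, f⟩, hf⟩
    exact ⟨⟨⟨r, mem_usefulRules.2 ⟨hr, hrA, isUseful_of_mem ⟨f⟩ (hA.finite_parseForests hr hrA)⟩⟩,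
      f, hf⟩, rfl⟩

/-- The parity of the number of sequences of parse trees of each string. -/
noncomputable def forestCount (g : ContextFreeGrammar.{u} T) (s : List (Symbol T g.NT))
    (w : List T) : ZMod 2 :=
  (parseForests g s w).ncard

open scoped Classical in
/-- The parity of the number of parse trees of each string. -/
noncomputable def symbolCount (g : ContextFreeGrammar.{u} T) : Symbol T g.NT → List T → ZMod 2
  | .terminal t => wordSingle (ZMod 2) [t]
  -- The value `0` is harmless, as other nonterminals never occur in `usefulRules`, and it lets the
  -- algebraicity statements hold for every symbol.
  | .nonterminal A => fun w => if IsUseful g A then ((parseTrees g A w).ncard : ZMod 2) else 0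

theorem forestCount_nil : forestCount g [] = wordSingle (ZMod 2) [] := by
  ext w
  rw [forestCount, wordSingle]
  split_ifs with h
  · have : parseForests g [] w = {ParseForest.nil} := by
      ext f
      cases f
      simp [parseForests, ParseForest.yield, h]
    simp [this]
  · have : parseForests g [] w = ∅ := by
      ext f
      cases f
      simp [parseForests, ParseForest.yield, Ne.symm h]
    simp [this]

theorem wordSingle_singleton_wordConv {k : Type*} [CommRing k] (t : T) (f : List T → k)
    (w : List T) : wordConv (wordSingle k [t]) f w =
      match w with
      | [] => 0
      | x :: w => wordSingle k [t] [x] * f w := by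
  rcases w with _ | ⟨x, w⟩
  · simp [wordConv, wordSingle]
  · rw [wordConv, Finset.sum_eq_single 1]
    · simp
    · intro i hi hne
      rw [Finset.mem_range, List.length_cons] at hi
      have : (x :: w).take i ≠ [t] := by
        intro h
        have := congrArg List.length h
        rw [List.length_take, List.length_cons, List.length_singleton] at this
        lia
      simp [wordSingle, this]
    · simp

theorem forestCount_cons_terminal (t : T) (s : List (Symbol T g.NT)) :
    forestCount g (.terminal t :: s) = wordConv (wordSingle (ZMod 2) [t]) (forestCount g s) := by
  ext w
  rw [wordSingle_singleton_wordConv]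
  rcases w with _ | ⟨x, w⟩
  · have : parseForests g (.terminal t :: s) [] = ∅ := by
      ext f
      cases f
      simp [parseForests, ParseForest.yield]
    simp [forestCount, this]
  · by_cases h : x = t
    · subst h
      have : parseForests g (.terminal x :: s) (x :: w) =
          ParseForest.terminal x '' parseForests g s w := by
        ext f
        cases f
        simp [parseForests, ParseForest.yield]
      rw [forestCount, this, Set.ncard_image_of_injective _ fun _ _ h => by simpa using h]
      simp [wordSingle, forestCount]
    · have : parseForests g (.terminal t :: s) (x :: w) = ∅ := by
        ext f
        cases f
        simp [parseForests, ParseForest.yield, Ne.symm h]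
      simp [forestCount, this, wordSingle, h]

theorem forestCount_cons {x : Symbol T g.NT} {s : List (Symbol T g.NT)}
    (hs : ∀ A, Symbol.nonterminal A ∈ x :: s → IsUseful g A) :
    forestCount g (x :: s) = wordConv (symbolCount g x) (forestCount g s) := by
  cases x with
  | terminal t => exact forestCount_cons_terminal t s
  | nonterminal A =>
    ext w
    have hA := hs A List.mem_cons_self
    have h1 (w) : Finite (parseTrees g A w) := hA.2 w
    have h2 (w) : Finite (parseForests g s w) :=
      finite_parseForests (fun A hA => hs A (List.mem_cons_of_mem _ hA)) w
    rw [forestCount, ← Nat.card_coe_set_eq,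
      ← Nat.card_congr (Equiv.ofBijective _ (bijective_parseForest_nonterminal A s w)),
      Nat.card_sigma, wordConv, Finset.sum_range]
    simp [symbolCount, hA, Nat.card_prod, forestCount]

theorem symbolCount_nonterminal {A : g.NT} (hA : IsUseful g A) :
    symbolCount g (.nonterminal A) =
      fun w => ∑ r ∈ usefulRules g A, forestCount g r.output w := by
  ext w
  have h1 (r : usefulRules g A) : Finite (parseForests g r.1.output w) :=
    hA.finite_parseForests (mem_usefulRules.1 r.2).1 (mem_usefulRules.1 r.2).2.1 w
  simp only [symbolCount, hA, if_true]
  rw [← Nat.card_coe_set_eq, ← Nat.card_congr (Equiv.ofBijective _ (bijective_parseTree_node hA w)),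
    Nat.card_sigma, ← Finset.sum_coe_sort (usefulRules g A)]
  simp [forestCount]

/-- Needed for the initial symbol, which fails to be useful when it has no parse tree at all; both
sides are then zero. -/
theorem symbolCount_nonterminal_of_finite {A : g.NT} (hA : ∀ w, (parseTrees g A w).Finite)
    (w : List T) : symbolCount g (.nonterminal A) w = ((parseTrees g A w).ncard : ZMod 2) := by
  rw [symbolCount]
  split_ifs with h
  · rfl
  · have : IsEmpty (ParseTree g A) := not_nonempty_iff.1 fun hne => h ⟨hne, hA⟩
    rw [Set.eq_empty_of_isEmpty (parseTrees g A w)]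
    simp

end ParseTrees

-- Linear part of a product of symbols

section Linearization

variable {T : Type u} {N K : Type*} [CommRing K]

open scoped Classical in
/-- The coefficient of the unknown `B` in the linear part of a string of symbols, where the symbols
to the left of it are evaluated by `p` and those to the right by `r`. -/
noncomputable def contextSum (p r : Symbol T N → K) (B : N) : List (Symbol T N) → K
  | [] => 0
  | x :: s => (if x = .nonterminal B then (s.map r).prod else 0) + p x * contextSum p r B s

theorem map_contextSum {K' : Type*} [CommRing K'] (φ : K →+* K') (p r : Symbol T N → K) (B : N)
    (s : List (Symbol T N)) :
    φ (contextSum p r B s) = contextSum (φ ∘ p) (φ ∘ r) B s := by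
  induction s with
  | nil => simp [contextSum]
  | cons x s ih =>
    simp only [contextSum, map_add, map_mul, ih, Function.comp_apply, apply_ite φ, map_zero,
      map_list_prod, List.map_map]

theorem contextSum_mem {R : Type*} [CommRing R] [Algebra R K] (S : Subalgebra R K)
    {p r : Symbol T N → K} (hp : ∀ x, p x ∈ S) (hr : ∀ x, r x ∈ S) (B : N)
    (s : List (Symbol T N)) : contextSum p r B s ∈ S := by
  induction s with
  | nil => exact S.zero_mem
  | cons x s ih =>
    refine S.add_mem ?_ (S.mul_mem (hp x) ih)
    split_ifs
    · refine S.list_prod_mem fun y hy => ?_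
      obtain ⟨z, _, rfl⟩ := List.mem_map.1 hy
      exact hr z
    · exact S.zero_mem

end Linearization

-- Nonvanishing of the determinant at the empty word

section Acyclicity

variable {T : Type u} {g : ContextFreeGrammar.{u} T}

theorem exists_parseTree_of_symbolCount_ne_zero {A : g.NT} {w : List T}
    (h : symbolCount g (.nonterminal A) w ≠ 0) : ∃ t : ParseTree g A, t.yield = w := by
  by_contra! hne
  apply h
  have : parseTrees g A w = ∅ := Set.eq_empty_of_forall_notMem hne
  simp [symbolCount, this]

theorem exists_parseForest_yield_nil {s : List (Symbol T g.NT)}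
    (h : (s.map fun x => symbolCount g x []).prod ≠ 0) : ∃ f : ParseForest g s, f.yield = [] := by
  induction s with
  | nil => exact ⟨.nil, rfl⟩
  | cons x s ih =>
    rw [List.map_cons, List.prod_cons] at h
    obtain ⟨f, hf⟩ := ih (right_ne_zero_of_mul h)
    cases x with
    | terminal t => simp [symbolCount, wordSingle] at h
    | nonterminal A =>
      obtain ⟨t, ht⟩ := exists_parseTree_of_symbolCount_ne_zero (left_ne_zero_of_mul h)
      exact ⟨.nonterminal t f, by simp [ParseForest.yield, ht, hf]⟩

/-- Some summand is nonzero: an occurrence of `B` in `s` all of whose neighbours have trees with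
empty yield. Plug `t` in at that occurrence. -/
theorem exists_parseForest_of_contextSum_ne_zero {B : g.NT} {s : List (Symbol T g.NT)}
    (h : contextSum (fun x => symbolCount g x []) (fun x => symbolCount g x []) B s ≠ 0)
    (t : ParseTree g B) :
    ∃ f : ParseForest g s, f.yield = t.yield ∧ t.numNodes ≤ f.numNodes := by
  induction s with
  | nil => simp [contextSum] at h
  | cons x s ih =>
    rw [contextSum] at h
    by_cases h0 : symbolCount g x [] *
        contextSum (fun x => symbolCount g x []) (fun x => symbolCount g x []) B s = 0
    · classical
      rw [h0, add_zero, ite_ne_right_iff] at h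
      obtain ⟨rfl, h⟩ := h
      obtain ⟨f, hf⟩ := exists_parseForest_yield_nil h
      exact ⟨.nonterminal t f, by simp [ParseForest.yield, hf], by simp [ParseForest.numNodes]⟩
    · obtain ⟨f, hf, hn⟩ := ih (right_ne_zero_of_mul h0)
      cases x with
      | terminal t => simp [symbolCount, wordSingle] at h0
      | nonterminal A =>
        obtain ⟨t', ht'⟩ := exists_parseTree_of_symbolCount_ne_zero (left_ne_zero_of_mul h0)
        refine ⟨.nonterminal t' f, by simp [ParseForest.yield, hf, ht'], ?_⟩
        rw [ParseForest.numNodes]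
        lia

/-- The matrix of the linearization of the system of equations of a grammar. -/
noncomputable def contextMatrix {K : Type*} [CommRing K] (g : ContextFreeGrammar.{u} T)
    (p r : Symbol T g.NT → K) : Matrix {A | IsUseful g A} {A | IsUseful g A} K :=
  Matrix.of fun A B => ∑ ρ ∈ usefulRules g A, contextSum p r B.1 ρ.output

theorem map_contextMatrix {K K' : Type*} [CommRing K] [CommRing K'] (φ : K →+* K')
    (p r : Symbol T g.NT → K) :
    (contextMatrix g p r).map φ = contextMatrix g (φ ∘ p) (φ ∘ r) := by
  ext A B
  simp [contextMatrix, map_contextSum]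

theorem exists_parseTree_of_contextMatrix_ne_zero {A B : {A | IsUseful g A}}
    (h : contextMatrix g (fun x => symbolCount g x []) (fun x => symbolCount g x []) A B ≠ 0)
    (t : ParseTree g B.1) :
    ∃ t' : ParseTree g A.1, t'.yield = t.yield ∧ t.numNodes < t'.numNodes := by
  obtain ⟨ρ, hρ, h⟩ := Finset.exists_ne_zero_of_sum_ne_zero h
  obtain ⟨f, hf, hn⟩ := exists_parseForest_of_contextSum_ne_zero h t
  rw [mem_usefulRules] at hρ
  refine ⟨.node ρ hρ.1 hρ.2.1 f, by simp [ParseTree.yield, hf], ?_⟩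
  rw [ParseTree.numNodes]
  lia

/-- A nonzero entry turns a tree of `B` into a strictly larger tree of `A` with the same yield. A
cycle would thus enlarge a tree that is maximal among the finitely many with its yield. So the
relation is well-founded, and a vector fixed by `M` vanishes by induction along it. -/
theorem det_one_sub_contextMatrix_symbolCount_nil_ne_zero
    [Fintype {A | IsUseful g A}] [DecidableEq {A | IsUseful g A}] :
    (1 - contextMatrix g (fun x => symbolCount g x []) (fun x => symbolCount g x [])).det ≠ 0 := by
  set M := contextMatrix g (fun x => symbolCount g x []) (fun x => symbolCount g x [])
  let E : {A | IsUseful g A} → {A | IsUseful g A} → Prop := fun B A => M A B ≠ 0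
  have htrans {B A} (h : Relation.TransGen E B A) (t : ParseTree g B.1) :
      ∃ t' : ParseTree g A.1, t'.yield = t.yield ∧ t.numNodes < t'.numNodes := by
    induction h with
    | single h => exact exists_parseTree_of_contextMatrix_ne_zero h t
    | tail _ h ih =>
      obtain ⟨t', h1, h2⟩ := ih
      obtain ⟨t'', h3, h4⟩ := exists_parseTree_of_contextMatrix_ne_zero h t'
      exact ⟨t'', h3.trans h1, h2.trans h4⟩
  have hirrefl : Std.Irrefl (Relation.TransGen E) := by
    refine ⟨fun A h => ?_⟩
    obtain ⟨t₀⟩ := A.2.1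
    obtain ⟨t, ht, hmax⟩ := Set.exists_max_image _ ParseTree.numNodes (A.2.2 t₀.yield)
      ⟨t₀, rfl⟩
    obtain ⟨t', h1, h2⟩ := htrans h t
    exact absurd (hmax t' (h1.trans ht)) (not_le.2 h2)
  have hwf : WellFounded (Relation.TransGen E) := Finite.wellFounded_of_trans_of_irrefl _
  intro hdet
  obtain ⟨v, hv, hMv⟩ := Matrix.exists_mulVec_eq_zero_iff.2 hdet
  rw [Matrix.sub_mulVec, Matrix.one_mulVec, sub_eq_zero] at hMv
  apply hv
  ext A
  induction A using hwf.induction with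
  | _ A ih =>
    rw [hMv]
    refine Finset.sum_eq_zero fun B _ => ?_
    by_cases h : M A B = 0
    · exact mul_eq_zero_of_left h _
    · exact mul_eq_zero_of_right _ (ih B (.single h))

end Acyclicity

-- Evaluating the parts on right-hand sides of rules

section Evaluation

variable {T : Type u} {g : ContextFreeGrammar.{u} T}

theorem aPart_forestCount (a : T) {s : List (Symbol T g.NT)}
    (hs : ∀ A, Symbol.nonterminal A ∈ s → IsUseful g A) :
    aPart a (forestCount g s) = (s.map fun x => aPart a (symbolCount g x)).prod := by
  induction s with
  | nil => rw [forestCount_nil, aPart_wordSingle_nil, List.map_nil, List.prod_nil]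
  | cons x s ih =>
    rw [forestCount_cons hs, aPart_wordConv, ih fun A hA => hs A (List.mem_cons_of_mem _ hA),
      List.map_cons, List.prod_cons]

theorem bPart_forestCount (b : T) {s : List (Symbol T g.NT)}
    (hs : ∀ A, Symbol.nonterminal A ∈ s → IsUseful g A) :
    bPart b (forestCount g s) = (s.map fun x => bPart b (symbolCount g x)).prod := by
  induction s with
  | nil => rw [forestCount_nil, bPart_wordSingle_nil, List.map_nil, List.prod_nil]
  | cons x s ih =>
    rw [forestCount_cons hs, bPart_wordConv, ih fun A hA => hs A (List.mem_cons_of_mem _ hA),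
      List.map_cons, List.prod_cons]

open PowerSeries in
theorem exists_abPart_forestCount_eq [Fintype {A | IsUseful g A}] (a b : T) {R : Type*}
    [CommRing R] [Algebra R (ZMod 2)⟦X⟧⟦X⟧] (S : Subalgebra R (ZMod 2)⟦X⟧⟦X⟧)
    (ha : ∀ x, aPart a (symbolCount g x) ∈ S) (hb : ∀ x, bPart b (symbolCount g x) ∈ S)
    {s : List (Symbol T g.NT)} (hs : ∀ A, Symbol.nonterminal A ∈ s → IsUseful g A) :
    ∃ f ∈ S, abPart a b (forestCount g s) = f + ∑ B : {A | IsUseful g A},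
      contextSum (fun x => aPart a (symbolCount g x)) (fun x => bPart b (symbolCount g x)) B.1 s *
        abPart a b (symbolCount g (.nonterminal B.1)) := by
  classical
  induction s with
  | nil => exact ⟨0, S.zero_mem, by simp [forestCount_nil, abPart_wordSingle_nil, contextSum]⟩
  | cons x s ih =>
    have hs' : ∀ A, Symbol.nonterminal A ∈ s → IsUseful g A :=
      fun A hA => hs A (List.mem_cons_of_mem _ hA)
    obtain ⟨f, hf, h⟩ := ih hs'
    rw [forestCount_cons hs, abPart_wordConv, h, mul_add, Finset.mul_sum]
    have hf' := S.mul_mem (ha x) hf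
    have hbs : bPart b (forestCount g s) ∈ S := by
      rw [bPart_forestCount b hs']
      refine S.list_prod_mem fun y hy => ?_
      obtain ⟨z, _, rfl⟩ := List.mem_map.1 hy
      exact hb z
    simp only [contextSum, add_mul, Finset.sum_add_distrib, ← bPart_forestCount b hs', mul_assoc]
    cases x with
    | terminal t =>
      -- On a single letter `abPart` equals `bPart`, so a terminal contributes only to the
      -- inhomogeneous term.
      refine ⟨_, S.add_mem hf' (S.mul_mem (hb (.terminal t)) hbs), ?_⟩
      simp only [symbolCount, abPart_wordSingle_singleton]
      simp
      ring
    | nonterminal A =>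
      refine ⟨_, hf', ?_⟩
      have hsum : ∑ B : {A | IsUseful g A},
          (if (Symbol.nonterminal A : Symbol T g.NT) = .nonterminal B.1 then bPart b (forestCount g s) else 0) *
            abPart a b (symbolCount g (.nonterminal B.1)) =
          bPart b (forestCount g s) * abPart a b (symbolCount g (.nonterminal A)) := by
        rw [Finset.sum_eq_single (⟨A, hs A List.mem_cons_self⟩ : {A | IsUseful g A})]
        · simp
        · intro B _ hB
          rw [if_neg, zero_mul]
          rintro h
          exact hB (Subtype.ext (Symbol.nonterminal.inj h).symm)
        · simp
      rw [hsum]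
      ring

end Evaluation

-- Algebraicity of solutions of the grammar's polynomial system

section Algebraicity

variable {T : Type u} {g : ContextFreeGrammar.{u} T} {R K : Type*} [CommRing R] [CommRing K]
  [Algebra R K]

open MvPolynomial

open scoped Classical in
/-- The polynomial represented by a symbol: useful nonterminals are the variables. -/
noncomputable def symbolPolynomial (g : ContextFreeGrammar.{u} T) (τ : T → R) :
    Symbol T g.NT → MvPolynomial {A | IsUseful g A} R
  | .terminal t => C (τ t)
  | .nonterminal A => if h : IsUseful g A then X ⟨A, h⟩ else 0

theorem aeval_prod_symbolPolynomial (τ : T → R) (p : Symbol T g.NT → K)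
    (hp : ∀ t, p (.terminal t) = algebraMap R K (τ t)) {s : List (Symbol T g.NT)}
    (hs : ∀ A, Symbol.nonterminal A ∈ s → IsUseful g A) :
    aeval (fun A : {A | IsUseful g A} => p (.nonterminal A.1))
      (s.map (symbolPolynomial g τ)).prod = (s.map p).prod := by
  rw [map_list_prod, List.map_map]
  congr 1
  refine List.map_congr_left fun x hx => ?_
  cases x with
  | terminal t => simp [symbolPolynomial, hp]
  | nonterminal A => simp [symbolPolynomial, hs A hx]

/-- By the Leibniz rule the Jacobian is the context matrix with equal left and right evaluations;
the linear system for `abPart` uses the same matrix with different ones. -/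
theorem aeval_pderiv_prod_symbolPolynomial (τ : T → R) (p : Symbol T g.NT → K)
    (hp : ∀ t, p (.terminal t) = algebraMap R K (τ t)) {s : List (Symbol T g.NT)}
    (hs : ∀ A, Symbol.nonterminal A ∈ s → IsUseful g A) (B : {A | IsUseful g A}) :
    aeval (fun A : {A | IsUseful g A} => p (.nonterminal A.1))
      (pderiv B (s.map (symbolPolynomial g τ)).prod) = contextSum p p B.1 s := by
  classical
  induction s with
  | nil => simp [contextSum]
  | cons x s ih =>
    have hs' : ∀ A, Symbol.nonterminal A ∈ s → IsUseful g A :=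
      fun A hA => hs A (List.mem_cons_of_mem _ hA)
    rw [List.map_cons, List.prod_cons, Derivation.leibniz, map_add, smul_eq_mul, smul_eq_mul,
      map_mul, map_mul, ih hs', aeval_prod_symbolPolynomial τ p hp hs', contextSum, add_comm]
    cases x with
    | terminal t => simp [symbolPolynomial, hp]
    | nonterminal A =>
      have hA := hs A List.mem_cons_self
      simp only [symbolPolynomial, hA, dite_true, aeval_X, pderiv_X, Symbol.nonterminal.injEq]
      congr 1
      by_cases h : A = B.1
      · subst h
        simp
      · have : (⟨A, hA⟩ : {A | IsUseful g A}) ≠ B := fun h' => h (congrArg Subtype.val h')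
        simp [h, this.symm]

theorem isAlgebraic_of_grammarSystem [IsDomain R] [IsDomain K] [FaithfulSMul R K]
    [Fintype {A | IsUseful g A}] [DecidableEq {A | IsUseful g A}]
    (τ : T → R) (p : Symbol T g.NT → K)
    (hp : ∀ t, p (.terminal t) = algebraMap R K (τ t))
    (hsys : ∀ A, IsUseful g A →
      p (.nonterminal A) = ∑ ρ ∈ usefulRules g A, (ρ.output.map p).prod)
    (hdet : (1 - contextMatrix g p p).det ≠ 0) (A : g.NT) (hA : IsUseful g A) :
    IsAlgebraic R (p (.nonterminal A)) := by
  refine isAlgebraic_of_polynomialSystem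
    (fun A => ∑ ρ ∈ usefulRules g A.1, (ρ.output.map (symbolPolynomial g τ)).prod)
    (fun A : {A | IsUseful g A} => p (.nonterminal A.1)) (fun A => ?_) ?_ ⟨A, hA⟩
  · rw [hsys A.1 A.2, map_sum]
    exact Finset.sum_congr rfl fun ρ hρ =>
      (aeval_prod_symbolPolynomial τ p hp (mem_usefulRules.1 hρ).2.2).symm
  · convert hdet using 3
    ext A B
    simp only [contextMatrix, Matrix.of_apply, map_sum]
    exact Finset.sum_congr rfl fun ρ hρ =>
      aeval_pderiv_prod_symbolPolynomial τ p hp (mem_usefulRules.1 hρ).2.2 B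

end Algebraicity

-- The polynomial multiplier and the theorem

section Main

variable {T : Type u} {g : ContextFreeGrammar.{u} T}

open PowerSeries

/-- Taking constant terms is a ring homomorphism, and it reduces both kinds of context matrix to the
one at the empty word. -/
theorem det_one_sub_contextMatrix_ne_zero
    [Fintype {A | IsUseful g A}] [DecidableEq {A | IsUseful g A}]
    (p r : Symbol T g.NT → (ZMod 2)⟦X⟧⟦X⟧)
    (hp : ∀ x, constantCoeff (constantCoeff (p x)) = symbolCount g x [])
    (hr : ∀ x, constantCoeff (constantCoeff (r x)) = symbolCount g x []) :
    (1 - contextMatrix g p r).det ≠ 0 := by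
  intro h
  let φ : (ZMod 2)⟦X⟧⟦X⟧ →+* ZMod 2 := constantCoeff.comp constantCoeff
  apply det_one_sub_contextMatrix_symbolCount_nil_ne_zero (g := g)
  have := congrArg φ h
  rw [RingHom.map_det, map_sub, map_one, map_zero, RingHom.mapMatrix_apply,
    map_contextMatrix] at this
  convert this using 4
  · ext x
    exact (hp x).symm
  · ext x
    exact (hr x).symm

theorem isAlgebraic_aPart_symbolCount (a : T) (x : Symbol T g.NT) :
    IsAlgebraic (Polynomial (Polynomial (ZMod 2))) (aPart a (symbolCount g x)) := by
  classical
  have := (finite_setOf_isUseful g).fintype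
  cases x with
  | terminal t =>
    rw [symbolCount, aPart_wordSingle_singleton]
    exact isAlgebraic_algebraMap _
  | nonterminal A =>
    by_cases hA : IsUseful g A
    · refine isAlgebraic_of_grammarSystem _ (fun x => aPart a (symbolCount g x))
        (fun t => aPart_wordSingle_singleton a t) (fun A hA => ?_)
        (det_one_sub_contextMatrix_ne_zero _ _ (fun _ => constantCoeff_aPart _ _)
          fun _ => constantCoeff_aPart _ _) A hA
      rw [symbolCount_nonterminal hA, aPart_sum]
      exact Finset.sum_congr rfl fun ρ hρ => aPart_forestCount a (mem_usefulRules.1 hρ).2.2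
    · have : aPart a (symbolCount g (.nonterminal A)) = 0 := by
        ext n m
        simp [symbolCount, hA, aPart]
      rw [this]
      exact isAlgebraic_zero

theorem isAlgebraic_bPart_symbolCount (b : T) (x : Symbol T g.NT) :
    IsAlgebraic (Polynomial (Polynomial (ZMod 2))) (bPart b (symbolCount g x)) := by
  classical
  have := (finite_setOf_isUseful g).fintype
  cases x with
  | terminal t =>
    rw [symbolCount, bPart_wordSingle_singleton]
    exact isAlgebraic_algebraMap _
  | nonterminal A =>
    by_cases hA : IsUseful g A
    · refine isAlgebraic_of_grammarSystem _ (fun x => bPart b (symbolCount g x))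
        (fun t => bPart_wordSingle_singleton b t) (fun A hA => ?_)
        (det_one_sub_contextMatrix_ne_zero _ _ (fun _ => constantCoeff_bPart _ _)
          fun _ => constantCoeff_bPart _ _) A hA
      rw [symbolCount_nonterminal hA, bPart_sum]
      exact Finset.sum_congr rfl fun ρ hρ => bPart_forestCount b (mem_usefulRules.1 hρ).2.2
    · have : bPart b (symbolCount g (.nonterminal A)) = 0 := by
        rw [bPart, ← map_zero C]
        congr 1
        ext m
        simp [symbolCount, hA]
      rw [this]
      exact isAlgebraic_zero

theorem exists_algebraMap_mul_abPart_mem (a b : T) (A : g.NT) :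
    ∃ p : Polynomial (Polynomial (ZMod 2)), p ≠ 0 ∧
      algebraMap _ (ZMod 2)⟦X⟧⟦X⟧ p * abPart a b (symbolCount g (.nonterminal A)) ∈
        fgCoeffSubalgebra (ZMod 2) := by
  classical
  by_cases hA : IsUseful g A
  · have := (finite_setOf_isUseful g).fintype
    -- Algebraicity makes the determinant divide a nonzero polynomial; the other factor carries the
    -- finiteness.
    let S := fgCoeffSubalgebra (ZMod 2) ⊓
      Subalgebra.algebraicClosure (Polynomial (Polynomial (ZMod 2))) (ZMod 2)⟦X⟧⟦X⟧
    have ha (x) : aPart a (symbolCount g x) ∈ S :=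
      ⟨aPart_mem_fgCoeffSubalgebra a _, isAlgebraic_aPart_symbolCount a x⟩
    have hb (x) : bPart b (symbolCount g x) ∈ S :=
      ⟨bPart_mem_fgCoeffSubalgebra b _, isAlgebraic_bPart_symbolCount b x⟩
    have hsys (A : {A | IsUseful g A}) : ∃ f ∈ S, abPart a b (symbolCount g (.nonterminal A.1)) =
        f + ∑ B, contextMatrix g (fun x => aPart a (symbolCount g x))
          (fun x => bPart b (symbolCount g x)) A B *
            abPart a b (symbolCount g (.nonterminal B.1)) := by
      have (ρ : ContextFreeRule T g.NT) (hρ : ρ ∈ usefulRules g A.1) :=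
        exists_abPart_forestCount_eq a b S ha hb (mem_usefulRules.1 hρ).2.2
      choose! f hf h using this
      refine ⟨∑ ρ ∈ usefulRules g A.1, f ρ, S.sum_mem hf, ?_⟩
      rw [symbolCount_nonterminal A.2, abPart_sum, Finset.sum_congr rfl h, Finset.sum_add_distrib,
        Finset.sum_comm]
      simp only [contextMatrix, Matrix.of_apply, Finset.sum_mul]
    choose f hf hsys using hsys
    obtain ⟨p, hp, hmem⟩ := exists_algebraMap_mul_mem_of_linearSystem S (fun z hz => hz.2) _ f
      (fun A : {A | IsUseful g A} => abPart a b (symbolCount g (.nonterminal A.1)))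
      (fun A B => S.sum_mem fun ρ _ => contextSum_mem S ha hb _ _) hf hsys
      (det_one_sub_contextMatrix_ne_zero _ _ (fun _ => constantCoeff_aPart _ _)
        fun _ => constantCoeff_bPart _ _) ⟨A, hA⟩
    exact ⟨p, hp, hmem.1⟩
  · refine ⟨1, one_ne_zero, ?_⟩
    have : abPart a b (symbolCount g (.nonterminal A)) = 0 := by
      ext n m
      simp [symbolCount, hA, abPart]
    rw [this, mul_zero]
    exact Subalgebra.zero_mem _

theorem coeffA_dual_language (a b : T) (G : GF2Grammar T) (n : ℕ) :
    coeffA (dual a b G.language) n =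
      coeff n (aPart a (symbolCount G.toContextFreeGrammar (.nonterminal G.initial)) +
        abPart a b (symbolCount G.toContextFreeGrammar (.nonterminal G.initial))) := by
  classical
  rw [coeff_aPart_add_abPart]
  ext m
  rw [coeffA, coeff_mk, coeff_mk, symbolCount_nonterminal_of_finite G.finite_parseTrees]
  have h0 : (Finsupp.single 0 n + Finsupp.single 1 m : Fin 2 →₀ ℕ) 0 = n := by simp
  have h1 : (Finsupp.single 0 n + Finsupp.single 1 m : Fin 2 →₀ ℕ) 1 = m := by simp
  rw [MvPowerSeries.coeff_apply, dual, h0, h1]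
  by_cases h : List.replicate n a ++ List.replicate m b ∈ G.language
  · rw [if_pos h]
    exact (ZMod.natCast_eq_one_iff_odd.2 h).symm
  · rw [if_neg h]
    exact (ZMod.natCast_eq_zero_iff_even.2 (Nat.not_odd_iff_even.1 h)).symm

end Main

theorem theorem3p2 {T : Type*} (a b : T) (hab : a ≠ b) (L : Language T)
    (hL : L ≤ starStar a b) (hG : IsGF2Grammatical L) :
    ∃ (d : ℕ) (p : Fin (d + 1) → Polynomial (ZMod 2)),
      p (Fin.last d) ≠ 0 ∧
      {s : PowerSeries (ZMod 2) | ∃ n : ℕ, d < n ∧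
        s = ∑ i : Fin (d + 1),
          (p i : PowerSeries (ZMod 2)) * coeffA (dual a b L) (n - (i : ℕ))}.Finite := by
  obtain ⟨G, rfl⟩ := hG
  obtain ⟨p, hp, hmem⟩ := exists_algebraMap_mul_abPart_mem (g := G.toContextFreeGrammar) a b
    G.initial
  -- The degree is taken in the outer variable `a`, so the coefficients are polynomials in `b` and
  -- the last one is the nonzero leading coefficient.
  refine ⟨p.natDegree, fun i => p.coeff i, by simpa using hp, ?_⟩
  simp only [coeffA_dual_language]
  refine finite_sum_polynomial_mul_coeff p _ ?_
  -- The `a^*` part already lies in the subalgebra, so the multiplier found for `abPart` serves for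
  -- the sum.
  rw [mul_add]
  exact Subalgebra.add_mem _ (Subalgebra.mul_mem _ (Subalgebra.algebraMap_mem _ p)
    (aPart_mem_fgCoeffSubalgebra a _)) hmem
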